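/- Let $K$ be a (commutative) field and let $n>1$ be an integer. Let $L=L_K(1,n)$ be the Leavitt algebra, i.e. the unital associative $K$-algebra generated by $a_1,\dots,a_n,a_1^*,\dots,a_n^*$ subject to the relations $$a_j^*a_i=\begin{cases}1 & \text{if } j=i,\\ 0 & \text{if } j\neq i,\end{cases}\qquad \sum_{i=1}^n a_ia_i^*=1 .$$ Then the following hold. 1. $L$ is a simple ring. 2. Every right ideal of $L$ is free as a right $L$-module. 3. $L$ is hereditary, i.e. all right ideals and all left ideals of $L$ are projective. 4. All projective right $L$-modules and all projective left $L$-modules (finitely generated or not) are free. 5. $L$ has module type $(1,n)$: the free right modules $L^1$ and $L^n$ are isomorphic, and whenever $1\le m'<n'$ are integers with $L^{m'}\cong L^{n'}$ as right modules, one has $n\le n'$. 6. The Grothendieck group $K_0(L)$, that is, the group completion of the commutative monoid of isomorphism classes of finitely generated projective right $L$-modules under direct sum, is isomorphic to $\mathbb{Z}/(n-1)\mathbb{Z}$, the cyclic group of order $n-1$. -/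

import Mathlib

universe u w

/-- The defining relations of the Leavitt algebra of type `(1, n)`, imposed on the free unital
associative algebra on letters `a i` (`Sum.inl i`) and `a* i` (`Sum.inr i`), `i : Fin n`. -/
inductive LeavittRel (K : Type u) [Field K] (n : ℕ) :
    FreeAlgebra K (Fin n ⊕ Fin n) → FreeAlgebra K (Fin n ⊕ Fin n) → Prop
  | star_mul_self (i : Fin n) :
      LeavittRel K n
        (FreeAlgebra.ι K (Sum.inr i) * FreeAlgebra.ι K (Sum.inl i)) 1
  | star_mul_of_ne (j i : Fin n) (h : j ≠ i) :
      LeavittRel K n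
        (FreeAlgebra.ι K (Sum.inr j) * FreeAlgebra.ι K (Sum.inl i)) 0
  | sum_mul_star :
      LeavittRel K n
        (∑ i : Fin n, FreeAlgebra.ι K (Sum.inl i) * FreeAlgebra.ι K (Sum.inr i)) 1

/-- The Leavitt algebra `L_K(1, n)`: the unital associative `K`-algebra generated by
`a i, a* i` (`i : Fin n`) subject to `a* j * a i = δ j i` and `∑ i, a i * a* i = 1`. -/
def LeavittAlgebra (K : Type u) [Field K] (n : ℕ) : Type u :=
  RingQuot (LeavittRel K n)

noncomputable instance LeavittAlgebra.instRing (K : Type u) [Field K] (n : ℕ) :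
    Ring (LeavittAlgebra K n) :=
  inferInstanceAs (Ring (RingQuot (LeavittRel K n)))

noncomputable instance LeavittAlgebra.instAlgebra (K : Type u) [Field K] (n : ℕ) :
    Algebra K (LeavittAlgebra K n) :=
  inferInstanceAs (Algebra K (RingQuot (LeavittRel K n)))

/-- Every right ideal of `R` is free as a right `R`-module. Right `R`-modules are modules over
`Rᵐᵒᵖ`, and right ideals are `Rᵐᵒᵖ`-submodules of `R`. -/
def AllRightIdealsFree (R : Type u) [Ring R] : Prop :=
  ∀ J : Submodule Rᵐᵒᵖ R, Module.Free Rᵐᵒᵖ J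

/-- A ring is hereditary if all its right ideals and all its left ideals are projective. -/
def IsHereditaryRing (R : Type u) [Ring R] : Prop :=
  (∀ J : Submodule Rᵐᵒᵖ R, Module.Projective Rᵐᵒᵖ J) ∧
    ∀ J : Submodule R R, Module.Projective R J

/-- The right `R`-modules `R ^ m` and `R ^ n` are isomorphic. -/
def FreeRanksIso (R : Type u) [Ring R] (m n : ℕ) : Prop :=
  Nonempty ((Fin m → R) ≃ₗ[Rᵐᵒᵖ] (Fin n → R))

/-- `R` has module type `(m, n)`: `1 ≤ m < n`, the free right modules of ranks `m` and `n` are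
isomorphic, and `m`, `n` are the smallest integers with these properties. -/
structure HasModuleType (R : Type u) [Ring R] (m n : ℕ) : Prop where
  one_le : 1 ≤ m
  lt : m < n
  iso : FreeRanksIso R m n
  least : ∀ m' n' : ℕ, 1 ≤ m' → m' < n' → FreeRanksIso R m' n' → m ≤ m' ∧ n ≤ n'

/-- A finitely generated projective right `R`-module. -/
structure FGProjRight (R : Type u) [Ring R] : Type (u + 1) where
  carrier : Type u
  [addCommGroup : AddCommGroup carrier]
  [module : Module Rᵐᵒᵖ carrier]
  [finite : Module.Finite Rᵐᵒᵖ carrier]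
  [projective : Module.Projective Rᵐᵒᵖ carrier]

namespace FGProjRight

attribute [instance] addCommGroup module finite projective

variable (R : Type u) [Ring R]

/-- Isomorphism of right modules. -/
instance setoid : Setoid (FGProjRight R) where
  r P Q := Nonempty (P.carrier ≃ₗ[Rᵐᵒᵖ] Q.carrier)
  iseqv :=
    { refl := fun _ => ⟨LinearEquiv.refl _ _⟩
      symm := fun ⟨e⟩ => ⟨e.symm⟩
      trans := fun ⟨e⟩ ⟨f⟩ => ⟨e.trans f⟩ }

/-- The isomorphism classes of finitely generated projective right `R`-modules. -/
def Classes : Type (u + 1) := Quotient (setoid R)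

/-- Addition is induced by the direct sum. -/
instance : Add (Classes R) where
  add := Quotient.map₂ (fun P Q => ⟨P.carrier × Q.carrier⟩)
    (fun _ _ ⟨e⟩ _ _ ⟨f⟩ => ⟨e.prodCongr f⟩)

/-- Zero is the class of the zero module. -/
instance : Zero (Classes R) where
  zero := Quotient.mk _ ⟨PUnit.{u + 1}⟩

instance : AddCommMonoid (Classes R) where
  add_assoc := by
    rintro ⟨P⟩ ⟨Q⟩ ⟨S⟩
    exact Quotient.sound ⟨LinearEquiv.prodAssoc Rᵐᵒᵖ P.carrier Q.carrier S.carrier⟩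
  zero_add := by
    rintro ⟨P⟩
    exact Quotient.sound ⟨LinearEquiv.uniqueProd⟩
  add_zero := by
    rintro ⟨P⟩
    exact Quotient.sound ⟨LinearEquiv.prodUnique⟩
  add_comm := by
    rintro ⟨P⟩ ⟨Q⟩
    exact Quotient.sound ⟨LinearEquiv.prodComm Rᵐᵒᵖ P.carrier Q.carrier⟩
  nsmul := nsmulRec

end FGProjRight

/-- `K_0(R)`: the Grothendieck group (group completion) of the commutative monoid of isomorphism
classes of finitely generated projective right `R`-modules under direct sum. -/
abbrev KZero (R : Type u) [Ring R] : Type (u + 1) :=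
  Algebra.GrothendieckAddGroup (FGProjRight.Classes R)

/-- All projective right `R`-modules and all projective left `R`-modules in the universe `w`,
finitely generated or not, are free. -/
def IsProjectiveFree (R : Type u) [Ring R] : Prop :=
  (∀ (P : Type w) [AddCommGroup P] [Module Rᵐᵒᵖ P],
      Module.Projective Rᵐᵒᵖ P → Module.Free Rᵐᵒᵖ P) ∧
    ∀ (P : Type w) [AddCommGroup P] [Module R P],
      Module.Projective R P → Module.Free R P

/-! Write F for the free algebra on the `b i`; for n > 1 its words stay linearly independent in S.
For every m, 1 is the sum of w* w over the words w of length m, where w* is the matching product of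
the `a i`. Moreover, for each x in a free left S-module there is an m such that all words of length
m carry x into the free F-module. So questions about S-modules descend to F by multiplying with long
words, and ascend again through that partition of 1.

Simplicity: a nonzero ideal contains a nonzero element of F, and two-sided multiplication turns it
into 1 (`exists_mul_mul_eq_one`). Freeness: a submodule N of a free S-module is generated by its
F-part, which is free over F by a leading-term argument, and an F-basis of it is an S-basis of N
(`free_submodule`). Hence projectives, which embed in free modules, are free.

Ranks: an isomorphism of S-modules that is integral on the basis restricts to an injection of free
F-modules with cokernel of finite K-dimension d. Counting one codimension in two ways shows that the
ranks agree modulo n - 1 (`exists_card_add_eq`); the general case reduces to this one by replacing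
S^k with S^(kn). The module type follows, and K_0 is cyclic, generated by the class of L, of order n
- 1.

The relations are symmetric under passing to the opposite ring and exchanging `a` with `b`, so
left-module results also give the right-module ones. -/

/-- Generators `a i, b i` of a `K`-algebra subject to the defining relations of the Leavitt algebra
of type `(1, n)`. -/
structure LeavittFamily (K : Type*) [Field K] (n : ℕ) (S : Type*) [Ring S] [Algebra K S] where
  a : Fin n → S
  b : Fin n → S
  b_mul_a : ∀ j i, b j * a i = if j = i then 1 else 0
  sum_a_mul_b : ∑ i, a i * b i = 1
  adjoin_eq_top : Algebra.adjoin K (Set.range a ∪ Set.range b) = ⊤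

/-! ### Leading terms and an ordering of words -/

section LeadingTerm

/-- `x` is the point of the support of `f` with the largest value of `C`. -/
def IsLead {K X Γ : Type*} [Zero K] [LE Γ] (C : X → Γ) (f : X →₀ K) (x : X) : Prop :=
  f x ≠ 0 ∧ ∀ y, f y ≠ 0 → C y ≤ C x

theorem exists_isLead {K X Γ : Type*} [Zero K] [LinearOrder Γ] (C : X → Γ) {f : X →₀ K}
    (hf : f ≠ 0) : ∃ x, IsLead C f x := by
  obtain ⟨x, hx, h⟩ := Finset.exists_max_image f.support C (Finsupp.support_nonempty_iff.2 hf)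
  exact ⟨x, by simpa using hx, fun y hy => h y (by simpa using hy)⟩

/-- At the largest leading point occurring in a combination only one term contributes, so nothing
can cancel it. -/
theorem linearIndependent_of_isLead {K X Γ T : Type*} [Field K] [LinearOrder Γ] {C : X → Γ}
    (hC : Function.Injective C) {g : T → X →₀ K} {l : T → X} (hl : Function.Injective l)
    (hg : ∀ t, IsLead C (g t) (l t)) : LinearIndependent K g := by
  rw [linearIndependent_iff]
  intro c hc
  by_contra hne
  obtain ⟨t, ht, h⟩ := exists_isLead (fun t => C (l t)) hne
  have h1 := DFunLike.congr_fun hc (l t)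
  rw [Finsupp.linearCombination_apply, Finsupp.sum, Finsupp.finsetSum_apply,
    Finset.sum_eq_single t] at h1
  · simp [ht, (hg t).1] at h1
  · intro s hs hst
    have hs' : c s ≠ 0 := by simpa using hs
    by_contra hne
    have h2 : g s (l t) ≠ 0 := fun h0 => hne (by simp [h0])
    exact hst (hl (hC (le_antisymm (h s hs') ((hg s).2 _ h2))))
  · intro h0
    simp_all

/-- Division algorithm: subtracting a multiple of some `g t` with the same leading point lowers the
leading point, and this terminates by well-foundedness. -/
theorem le_span_of_isLead {K X Γ T : Type*} [Field K] [LinearOrder Γ] [WellFoundedLT Γ]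
    {C : X → Γ} (hC : Function.Injective C) {V : Submodule K (X →₀ K)} {g : T → X →₀ K}
    (hg : ∀ t, g t ∈ V) (hcover : ∀ f ∈ V, ∀ x, IsLead C f x → ∃ t, IsLead C (g t) x) :
    V ≤ Submodule.span K (Set.range g) := by
  have key : ∀ γ : Γ, ∀ f ∈ V, ∀ x, C x = γ → IsLead C f x →
      f ∈ Submodule.span K (Set.range g) := by
    intro γ
    induction γ using WellFoundedLT.induction with
    | ind γ ih =>
      intro f hf x hx hfx
      obtain ⟨t, ht⟩ := hcover f hf x hfx
      have hsub : f - (f x / g t x) • g t ∈ Submodule.span K (Set.range g) := by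
        by_cases h0 : f - (f x / g t x) • g t = 0
        · rw [h0]; exact zero_mem _
        obtain ⟨y, hy⟩ := exists_isLead C h0
        refine ih (C y) ?_ _ (V.sub_mem hf (V.smul_mem _ (hg t))) y rfl hy
        have hyx : C y ≤ C x := by
          by_contra hlt
          have h1 : f y = 0 := by
            by_contra h; exact hlt (hfx.2 y h)
          have h2 : g t y = 0 := by
            by_contra h; exact hlt (ht.2 y h)
          exact hy.1 (by simp [h1, h2])
        rw [← hx]
        refine lt_of_le_of_ne hyx fun h => hy.1 ?_
        rw [hC h]
        simp [div_mul_cancel₀ _ ht.1]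
      have := add_mem hsub (Submodule.smul_mem _ (f x / g t x)
        (Submodule.subset_span (Set.mem_range_self t)))
      simpa using this
  intro f hf
  by_cases h0 : f = 0
  · rw [h0]; exact zero_mem _
  obtain ⟨x, hx⟩ := exists_isLead C h0
  exact key _ f hf x rfl hx

/-- The position of a word in the enumeration by length and then by letters. -/
def wordCode {n : ℕ} : List (Fin n) → ℕ
  | [] => 0
  | i :: w => n * wordCode w + i + 1

/-- This is bijective base-`n` numeration with digits 1, …, n; the first letter is the least
significant digit. -/
theorem wordCode_injective {n : ℕ} : Function.Injective (wordCode (n := n)) := by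
  intro u
  induction u with
  | nil => intro v h; cases v with
    | nil => rfl
    | cons j v => simp [wordCode] at h
  | cons i u ih => intro v h; cases v with
    | nil => simp [wordCode] at h
    | cons j v =>
      simp only [wordCode, add_left_inj] at h
      have hm := congrArg (· % n) h
      simp only [Nat.mul_add_mod, Nat.mod_eq_of_lt i.2, Nat.mod_eq_of_lt j.2] at hm
      have hn : 0 < n := i.pos
      rw [hm, add_left_inj] at h
      rw [ih (Nat.eq_of_mul_eq_mul_left hn h), Fin.ext hm]

theorem wordCode_append_le {n : ℕ} (w : List (Fin n)) {u v : List (Fin n)}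
    (h : wordCode u ≤ wordCode v) : wordCode (w ++ u) ≤ wordCode (w ++ v) := by
  induction w with
  | nil => simpa
  | cons i w ih =>
    simp only [List.cons_append, wordCode]
    gcongr

end LeadingTerm

/-! ### Words in the `b i` and their cancellation against the `a i` -/

namespace LeavittFamily

variable {K : Type*} [Field K] {n : ℕ} {S : Type*} [Ring S] [Algebra K S]
  (A : LeavittFamily K n S)

/-- The monomial in the generators `b i` given by a word. -/
def word (w : List (Fin n)) : S := (w.map A.b).prod

/-- The monomial in the generators `a i` given by the reversed word. -/
def starWord (w : List (Fin n)) : S := (w.reverse.map A.a).prod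

@[simp] theorem word_nil : A.word [] = 1 := rfl

theorem word_append (v w : List (Fin n)) : A.word (v ++ w) = A.word v * A.word w := by
  simp [word]

theorem word_concat (w : List (Fin n)) (i : Fin n) : A.word (w ++ [i]) = A.word w * A.b i := by
  simp [word]

theorem word_mul_starWord_self (w : List (Fin n)) : A.word w * A.starWord w = 1 := by
  induction w using List.reverseRecOn with
  | nil => simp [starWord]
  | append_singleton w i ih =>
    rw [word_concat, show A.starWord (w ++ [i]) = A.a i * A.starWord w by simp [starWord],
      mul_assoc, ← mul_assoc (A.b i), A.b_mul_a]
    simpa using ih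

/-- Letters cancel from the inside: the product vanishes unless `v` is a suffix of `w`, and then the
remaining prefix `u` survives. -/
theorem word_mul_starWord (v w : List (Fin n)) (h : v.length ≤ w.length) (hne : w ≠ v) :
    A.word w * A.starWord v = 0 ∨
      ∃ u, u ≠ [] ∧ u.length ≤ w.length ∧ A.word w * A.starWord v = A.word u := by
  induction v using List.reverseRecOn generalizing w with
  | nil => exact Or.inr ⟨w, hne, le_rfl, by simp [starWord]⟩
  | append_singleton v i ih =>
    obtain rfl | ⟨w, j, rfl⟩ := List.eq_nil_or_concat' w
    · simp at h
    simp only [List.length_append, List.length_singleton] at h ⊢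
    rw [word_concat, show A.starWord (v ++ [i]) = A.a i * A.starWord v by simp [starWord],
      mul_assoc, ← mul_assoc (A.b j), A.b_mul_a]
    by_cases hij : j = i
    · subst hij
      simp only [if_true, one_mul]
      rcases ih w (by omega) (fun h => hne (by rw [h])) with h | ⟨u, h1, h2, h3⟩
      · exact Or.inl h
      · exact Or.inr ⟨u, h1, by omega, h3⟩
    · simp [hij]

theorem word_mul_pow (x : Fin n) (u : List (Fin n)) (l : ℕ) :
    A.word u * A.a x ^ (u.length + l) = 0 ∨ A.word u * A.a x ^ (u.length + l) = A.a x ^ l := by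
  induction u using List.reverseRecOn with
  | nil => simp
  | append_singleton u j ih =>
    rw [List.length_append, List.length_singleton,
      show u.length + 1 + l = (u.length + l) + 1 by omega, pow_succ', word_concat, mul_assoc,
      ← mul_assoc (A.b j), A.b_mul_a]
    by_cases h : j = x
    · simpa [h] using ih
    · simp [h]

theorem pow_b_mul_pow_a (x : Fin n) (k l : ℕ) : A.b x ^ (k + l) * A.a x ^ l = A.b x ^ k := by
  induction l with
  | zero => simp
  | succ l ih =>
    rw [← add_assoc, pow_succ, pow_succ', mul_assoc, ← mul_assoc (A.b x), A.b_mul_a]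
    simpa using ih

theorem conj_word_eq_zero {x y : Fin n} (hxy : x ≠ y) {u : List (Fin n)} (hu : u ≠ []) {m : ℕ}
    (hm : u.length ≤ m) : A.b x ^ m * A.word u * A.a x ^ m * A.a y = 0 := by
  obtain ⟨l, rfl⟩ := Nat.exists_eq_add_of_le hm
  rw [mul_assoc (A.b x ^ _)]
  rcases A.word_mul_pow x u l with h | h
  · simp [h]
  · rw [h, pow_b_mul_pow_a]
    obtain ⟨k, hk⟩ := Nat.exists_eq_succ_of_ne_zero (mt List.length_eq_zero_iff.1 hu)
    rw [hk, pow_succ, mul_assoc, A.b_mul_a]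
    simp [hxy]

/-- Right multiplication by `starWord` of a shortest word w₀ of the support makes its term a nonzero
scalar and leaves otherwise only nonempty words. With x ≠ y, multiplying by `b x ^ m` on the left
and `a x ^ m * a y` on the right kills every nonempty word of length at most m, while 1 becomes `a
y`. -/
theorem exists_mul_mul_eq_one (hn : 1 < n) {c : List (Fin n) →₀ K} (hc : c ≠ 0) :
    ∃ u v : S, u * Finsupp.linearCombination K A.word c * v = 1 := by
  obtain ⟨w₀, hw₀, hmin⟩ := Finset.exists_min_image c.support List.length
    (Finsupp.support_nonempty_iff.2 hc)
  obtain ⟨m, hm⟩ : ∃ m, ∀ w ∈ c.support, w.length ≤ m :=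
    ⟨c.support.sup List.length, fun w hw => Finset.le_sup (f := List.length) hw⟩
  let x : Fin n := ⟨0, by omega⟩
  let y : Fin n := ⟨1, hn⟩
  have hxy : x ≠ y := by simp [x, y]
  have hw₀' : c w₀ ≠ 0 := by simpa using hw₀
  refine ⟨(c w₀)⁻¹ • (A.b y * A.b x ^ m), A.starWord w₀ * (A.a x ^ m * A.a y), ?_⟩
  have key : Finsupp.linearCombination K A.word c * (A.starWord w₀ * (A.a x ^ m * A.a y)) =
      ∑ w ∈ c.support, c w • (A.word w * A.starWord w₀ * A.a x ^ m * A.a y) := by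
    simp [Finsupp.linearCombination_apply, Finsupp.sum, Finset.sum_mul, mul_assoc]
  have h1 : A.b x ^ m * A.a x ^ m = 1 := by simpa using A.pow_b_mul_pow_a x 0 m
  rw [mul_assoc, key, Finset.mul_sum, Finset.sum_eq_single w₀]
  · rw [A.word_mul_starWord_self, one_mul]
    simp only [smul_mul_assoc, mul_smul_comm, smul_smul]
    rw [mul_inv_cancel₀ hw₀', one_smul, mul_assoc, ← mul_assoc (A.b x ^ m), h1, one_mul,
      A.b_mul_a, if_pos rfl]
  · intro w hw hne
    suffices h : A.b x ^ m * (A.word w * A.starWord w₀ * A.a x ^ m * A.a y) = 0 by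
      rw [smul_mul_assoc, mul_smul_comm, mul_assoc, h]
      simp
    rcases A.word_mul_starWord w₀ w (hmin w hw) hne with h | ⟨u, hu, hul, h⟩
    · simp [h]
    · rw [h]
      simpa only [mul_assoc] using A.conj_word_eq_zero hxy hu (hul.trans (hm w hw))
  · intro h; exact absurd hw₀ h

theorem linearIndependent_word [Nontrivial S] (hn : 1 < n) : LinearIndependent K A.word := by
  rw [linearIndependent_iff]
  intro c hc
  by_contra hne
  obtain ⟨u, v, h⟩ := A.exists_mul_mul_eq_one hn hne
  simp [hc] at h

/-! ### Clearing denominators by long words; simplicity -/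

section Eval

variable (ι : Type*)

/-- The free module over the free algebra on the `b i`, mapped into the free `S`-module. -/
noncomputable def eval : (ι × List (Fin n) →₀ K) →ₗ[K] (ι →₀ S) :=
  Finsupp.linearCombination K fun x => Finsupp.single x.1 (A.word x.2)

/-- Multiplication by a word on the free module over the free algebra. -/
noncomputable def shift (K : Type*) [Field K] {n : ℕ} (ι : Type*) (w : List (Fin n)) :
    (ι × List (Fin n) →₀ K) →ₗ[K] (ι × List (Fin n) →₀ K) :=
  Finsupp.lmapDomain K K (Prod.map id (w ++ ·))

variable {ι}

@[simp] theorem eval_single (x : ι × List (Fin n)) (r : K) :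
    A.eval ι (Finsupp.single x r) = r • Finsupp.single x.1 (A.word x.2) := by
  simp [eval, Finsupp.linearCombination_single]

@[simp] theorem shift_single (w : List (Fin n)) (x : ι × List (Fin n)) (r : K) :
    shift K ι w (Finsupp.single x r) = Finsupp.single (x.1, w ++ x.2) r :=
  Finsupp.mapDomain_single

theorem eval_shift (w : List (Fin n)) (f : ι × List (Fin n) →₀ K) :
    A.eval ι (shift K ι w f) = A.word w • A.eval ι f := by
  induction f using Finsupp.induction_linear with
  | zero => simp
  | add f g hf hg => simp [hf, hg]
  | single x r =>
    rw [shift_single, eval_single, eval_single, word_append, smul_comm,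
      Finsupp.smul_single (A.word w), smul_eq_mul]

theorem eval_apply (f : ι × List (Fin n) →₀ K) (i : ι) :
    A.eval ι f i = Finsupp.linearCombination K A.word (f.curry i) := by
  classical
  induction f using Finsupp.induction_linear with
  | zero => simp [show (0 : ι × List (Fin n) →₀ K).curry = 0 from rfl]
  | add f g hf hg =>
    rw [map_add, Finsupp.add_apply, hf, hg, ← map_add]
    exact congrArg _ (Finsupp.ext fun _ => rfl)
  | single x r =>
    obtain ⟨j, w⟩ := x
    by_cases h : j = i
    · subst h; simp [Finsupp.curry_single]
    · simp [Finsupp.curry_single, h]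

theorem eval_injective [Nontrivial S] (hn : 1 < n) : Function.Injective (A.eval ι) := by
  rw [← LinearMap.ker_eq_bot, LinearMap.ker_eq_bot']
  intro f hf
  have h : f.curry = 0 := by
    ext1 i
    refine linearIndependent_iff.1 (A.linearIndependent_word hn) _ ?_
    rw [← eval_apply, hf]; rfl
  ext ⟨i, w⟩
  have := DFunLike.congr_fun (DFunLike.congr_fun h i) w
  simpa using this

theorem word_smul_mem_range_eval {x : ι →₀ S} (hx : x ∈ LinearMap.range (A.eval ι))
    (w : List (Fin n)) : A.word w • x ∈ LinearMap.range (A.eval ι) := by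
  obtain ⟨f, rfl⟩ := hx
  exact ⟨shift K ι w f, A.eval_shift w f⟩

/-- The elements which all words of length `m` multiply into the range of `eval`. -/
def IntegralAt (m : ℕ) (x : ι →₀ S) : Prop :=
  ∀ w : List (Fin n), w.length = m → A.word w • x ∈ LinearMap.range (A.eval ι)

variable {A}

theorem IntegralAt.succ {m : ℕ} {x : ι →₀ S} (h : A.IntegralAt m x) :
    A.IntegralAt (m + 1) x := by
  intro w hw
  cases w with
  | nil => simp at hw
  | cons i w =>
    have := A.word_smul_mem_range_eval (h w (by simpa using hw)) [i]
    rwa [smul_smul, ← word_append] at this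

theorem IntegralAt.mono {m m' : ℕ} (hm : m ≤ m') {x : ι →₀ S} (h : A.IntegralAt m x) :
    A.IntegralAt m' x := by
  induction hm with
  | refl => exact h
  | step _ ih => exact ih.succ

theorem IntegralAt.add {m : ℕ} {x y : ι →₀ S} (hx : A.IntegralAt m x) (hy : A.IntegralAt m y) :
    A.IntegralAt m (x + y) := by
  intro w hw
  rw [smul_add]
  exact add_mem (hx w hw) (hy w hw)

theorem IntegralAt.b_smul {m : ℕ} {x : ι →₀ S} (h : A.IntegralAt (m + 1) x) (i : Fin n) :
    A.IntegralAt m (A.b i • x) := by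
  intro w hw
  rw [smul_smul, ← word_concat]
  exact h _ (by simp [hw])

theorem IntegralAt.a_smul {m : ℕ} {x : ι →₀ S} (h : A.IntegralAt m x) (i : Fin n) :
    A.IntegralAt (m + 1) (A.a i • x) := by
  intro w hw
  obtain rfl | ⟨w, j, rfl⟩ := List.eq_nil_or_concat' w
  · simp at hw
  rw [word_concat, smul_smul, mul_assoc, A.b_mul_a]
  split_ifs
  · simpa using h w (by simpa using hw)
  · simp

variable (A)

/-- Multiplication by `a i` raises the required length by at most one, and multiplication by `b i`
does not raise it; these generate S, and the basis vectors are integral at length 0. -/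
theorem exists_integralAt (x : ι →₀ S) : ∃ m, A.IntegralAt m x := by
  have hmul : ∀ s : S, ∀ x : ι →₀ S, (∃ m, A.IntegralAt m x) → ∃ m, A.IntegralAt m (s • x) := by
    intro s
    have hs : s ∈ Algebra.adjoin K (Set.range A.a ∪ Set.range A.b) := by
      rw [A.adjoin_eq_top]; trivial
    induction hs using Algebra.adjoin_induction with
    | mem s hs =>
      rintro x ⟨m, hm⟩
      rcases hs with ⟨i, rfl⟩ | ⟨i, rfl⟩
      · exact ⟨_, hm.a_smul i⟩
      · exact ⟨m, hm.succ.b_smul i⟩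
    | algebraMap r =>
      rintro x ⟨m, hm⟩
      refine ⟨m, fun w hw => ?_⟩
      rw [algebraMap_smul, smul_comm]
      exact Submodule.smul_mem _ _ (hm w hw)
    | add s t _ _ hs ht =>
      intro x hx
      obtain ⟨m, hm⟩ := hs x hx
      obtain ⟨m', hm'⟩ := ht x hx
      refine ⟨max m m', ?_⟩
      rw [add_smul]
      exact (hm.mono (le_max_left _ _)).add (hm'.mono (le_max_right _ _))
    | mul s t _ _ hs ht =>
      intro x hx
      rw [mul_smul]
      exact hs _ (ht x hx)
  induction x using Finsupp.induction_linear with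
  | zero => exact ⟨0, fun w _ => by simp⟩
  | add x y hx hy =>
    obtain ⟨m, hm⟩ := hx
    obtain ⟨m', hm'⟩ := hy
    exact ⟨max m m', (hm.mono (le_max_left _ _)).add (hm'.mono (le_max_right _ _))⟩
  | single i s =>
    have := hmul s (Finsupp.single i 1) ⟨0, fun w hw => ?_⟩
    · simpa using this
    · exact ⟨Finsupp.single (i, w) 1, by simp⟩

theorem sum_a_smul_b_smul {M : Type*} [AddCommGroup M] [Module S M] (x : M) :
    ∑ i, A.a i • A.b i • x = x := by
  simp_rw [smul_smul]
  rw [← Finset.sum_smul, A.sum_a_mul_b, one_smul]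

/-- Iterating x = ∑ a_i b_i x recovers x from its multiples by the words of length `m`. With N = ⊥
this says that these words have no common annihilated vector but 0. -/
theorem mem_of_word_smul_mem {M : Type*} [AddCommGroup M] [Module S M] (N : Submodule S M)
    (m : ℕ) {x : M} (h : ∀ w : List (Fin n), w.length = m → A.word w • x ∈ N) : x ∈ N := by
  induction m generalizing x with
  | zero => simpa using h [] rfl
  | succ m ih =>
    rw [← A.sum_a_smul_b_smul x]
    refine sum_mem fun i _ => N.smul_mem _ (ih fun w hw => ?_)
    rw [smul_smul, ← word_concat]
    exact h _ (by simp [hw])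

theorem isSimpleRing (A : LeavittFamily K n S) [Nontrivial S] (hn : 1 < n) : IsSimpleRing S := by
  refine ⟨⟨fun I => or_iff_not_imp_left.2 fun hI => ?_⟩⟩
  obtain ⟨x, hxI, hx⟩ : ∃ x ∈ I, x ≠ 0 := by
    by_contra! h
    exact hI (le_bot_iff.1 fun x hx => by simpa using h x hx)
  obtain ⟨m, hm⟩ := A.exists_integralAt (Finsupp.single () x)
  obtain ⟨w, hw, hwx⟩ : ∃ w : List (Fin n), w.length = m ∧ A.word w * x ≠ 0 := by
    by_contra! h
    exact hx ((Submodule.mem_bot S).1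
      (A.mem_of_word_smul_mem ⊥ m fun w hw => (Submodule.mem_bot S).2 (h w hw)))
  obtain ⟨f, hf⟩ := hm w hw
  have hfx := DFunLike.congr_fun hf ()
  rw [eval_apply] at hfx
  simp only [Finsupp.smul_single, smul_eq_mul, Finsupp.single_eq_same] at hfx
  obtain ⟨u, v, huv⟩ := A.exists_mul_mul_eq_one hn (c := f.curry ())
    (fun h => hwx (by rw [← hfx, h, map_zero]))
  rw [← I.one_mem_iff, ← huv, hfx]
  exact I.mul_mem_right _ _ (I.mul_mem_left _ _ (I.mul_mem_left _ _ hxI))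

end Eval

/-! ### Submodules of free modules are free -/

section Free

theorem isLead_shift {ι : Type*} [LinearOrder ι] {f : ι × List (Fin n) →₀ K}
    {x : ι × List (Fin n)} (h : IsLead (fun y => toLex (y.1, wordCode y.2)) f x)
    (w : List (Fin n)) :
    IsLead (fun y => toLex (y.1, wordCode y.2)) (shift K ι w f) (x.1, w ++ x.2) := by
  have hinj : Function.Injective (Prod.map (id : ι → ι) (w ++ ·)) :=
    Function.injective_id.prodMap (List.append_right_injective w)
  constructor
  · have := Finsupp.mapDomain_apply hinj f x
    exact fun h0 => h.1 (this.symm.trans h0)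
  · intro y hy
    have : y ∈ Set.range (Prod.map (id : ι → ι) (w ++ ·)) := by
      by_contra hy'
      exact hy (Finsupp.mapDomain_of_notMem_range f y hy')
    obtain ⟨z, rfl⟩ := this
    have hz := h.2 z fun h0 => hy ((Finsupp.mapDomain_apply hinj f z).trans h0)
    simp only [Prod.map, id, Prod.Lex.toLex_le_toLex] at hz ⊢
    exact hz.imp_right fun h => ⟨h.1, wordCode_append_le w h.2⟩

/-- The F-part `V` of N has an F-basis indexed by the minimal leading positions; long words transfer
its independence and spanning property to S. -/
theorem free_submodule (A : LeavittFamily K n S) [Nontrivial S] (hn : 1 < n)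
    {ι : Type*} (N : Submodule S (ι →₀ S)) :
    Module.Free S N := by
  obtain ⟨_, _⟩ := exists_wellFoundedLT ι
  -- A well-order on positions, preserved by prepending a word; the well-order on `ι` is an
  -- arbitrary choice.
  let C : ι × List (Fin n) → Lex (ι × ℕ) := fun y => toLex (y.1, wordCode y.2)
  have hC : Function.Injective C := fun x y h => by
    have := toLex.injective h
    rw [Prod.mk.injEq] at this
    exact Prod.ext this.1 (wordCode_injective this.2)
  let V : Submodule K (ι × List (Fin n) →₀ K) := (N.restrictScalars K).comap (A.eval ι)
  let D : Set (ι × List (Fin n)) := {x | ∃ f ∈ V, IsLead C f x}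
  -- `D` is closed under prepending words, so failure for the immediate tail means that no proper
  -- suffix lies in `D`. Each position in `D` is then uniquely a word followed by an element of `P`,
  -- and the shifts of the `f p` have each leading position exactly once.
  let P : Set (ι × List (Fin n)) := {x | x ∈ D ∧ ∀ i q, x.2 = i :: q → (x.1, q) ∉ D}
  choose f hfV hf using fun p : P => p.2.1
  have hVshift : ∀ w, ∀ f ∈ V, shift K ι w f ∈ V := fun w f hfV => by
    change A.eval ι _ ∈ N
    rw [eval_shift]
    exact N.smul_mem _ hfV
  let g : P × List (Fin n) → ι × List (Fin n) →₀ K := fun t => shift K ι t.2 (f t.1)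
  let l : P × List (Fin n) → ι × List (Fin n) := fun t => (t.1.1.1, t.2 ++ t.1.1.2)
  have hg : ∀ t, IsLead C (g t) (l t) := fun t => isLead_shift (hf t.1) t.2
  have hgV : ∀ t, g t ∈ V := fun t => hVshift _ _ (hfV t.1)
  have hDappend : ∀ i w q, (i, q) ∈ D → (i, w ++ q) ∈ D := by
    rintro i w q ⟨f, hfV, hf⟩
    exact ⟨_, hVshift w f hfV, isLead_shift hf w⟩
  have hl : Function.Injective l := by
    have aux : ∀ (i : ι) (w p w' p' : List (Fin n)), (i, p) ∈ P → (i, p') ∈ P →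
        w ++ p = w' ++ p' → w.length ≤ w'.length → w = w' ∧ p = p' := by
      intro i w p w' p' hp hp' h hlen
      obtain ⟨u, rfl, rfl⟩ : ∃ u, w' = w ++ u ∧ p = u ++ p' := by
        rcases List.append_eq_append_iff.1 h with ⟨u, h1, h2⟩ | ⟨u, h1, h2⟩
        · exact ⟨u, h1, h2⟩
        · have : u = [] := by
            rw [h1, List.length_append] at hlen
            exact List.length_eq_zero_iff.1 (by omega)
          subst this
          exact ⟨[], by simpa using h1.symm, by simpa using h2.symm⟩
      cases u with
      | nil => simp
      | cons j u => exact absurd (hDappend i u p' hp'.1) (hp.2 j _ rfl)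
    rintro ⟨⟨⟨i, p⟩, hp⟩, w⟩ ⟨⟨⟨i', p'⟩, hp'⟩, w'⟩ h
    simp only [l, Prod.mk.injEq] at h
    obtain ⟨rfl, h⟩ := h
    rcases le_total w.length w'.length with hlen | hlen
    · obtain ⟨rfl, rfl⟩ := aux i w p w' p' hp hp' h hlen; rfl
    · obtain ⟨rfl, rfl⟩ := aux i w' p' w p hp' hp h.symm hlen; rfl
  have hDl : ∀ (q : List (Fin n)) (i : ι), (i, q) ∈ D → ∃ t, l t = (i, q) := by
    intro q i
    induction q with
    | nil => exact fun h => ⟨⟨⟨(i, []), h, by simp⟩, []⟩, rfl⟩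
    | cons j q ih =>
      intro h
      by_cases hq : (i, q) ∈ D
      · obtain ⟨⟨p, w⟩, ht⟩ := ih hq
        simp only [l, Prod.mk.injEq] at ht
        exact ⟨⟨p, j :: w⟩, by simp [l, ht]⟩
      · refine ⟨⟨⟨(i, j :: q), h, ?_⟩, []⟩, rfl⟩
        intro j' q' hjq
        simp only [List.cons.injEq] at hjq
        rwa [← hjq.2]
  have hspan : V ≤ Submodule.span K (Set.range g) := le_span_of_isLead hC hgV fun f hfV x hx => by
    obtain ⟨t, ht⟩ := hDl x.2 x.1 ⟨f, hfV, hx⟩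
    exact ⟨t, (show l t = x from ht) ▸ hg t⟩
  have hind : LinearIndependent K g := linearIndependent_of_isLead hC hl hg
  let H : (P →₀ S) →ₗ[S] (ι →₀ S) := Finsupp.linearCombination S fun p => A.eval ι (f p)
  have hH : ∀ c, H (A.eval P c) = A.eval ι (Finsupp.linearCombination K g c) := by
    intro c
    induction c using Finsupp.induction_linear with
    | zero => simp
    | add c d hc hd => simp [hc, hd]
    | single t r =>
      simp only [H, g, eval_single, Finsupp.linearCombination_single, map_smul, eval_shift,
        Finsupp.smul_single, smul_assoc]
  have hinj : Function.Injective H := by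
    refine (injective_iff_map_eq_zero H).2 fun s hs => ?_
    obtain ⟨m, hm⟩ := A.exists_integralAt s
    refine (Submodule.mem_bot S).1 (A.mem_of_word_smul_mem ⊥ m fun w hw => ?_)
    obtain ⟨c, hc⟩ := hm w hw
    have h0 : A.eval ι (Finsupp.linearCombination K g c) = 0 := by
      rw [← hH, hc, map_smul, hs, smul_zero]
    have hc0 : c = 0 := linearIndependent_iff.1 hind c
      (A.eval_injective hn (h0.trans (map_zero _).symm))
    rw [← hc, hc0, map_zero]
    exact zero_mem _
  have hrange : LinearMap.range H = N := by
    apply le_antisymm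
    · refine (Finsupp.range_linearCombination S).trans_le (Submodule.span_le.2 ?_)
      rintro _ ⟨p, rfl⟩
      exact hfV p
    · intro x hx
      obtain ⟨m, hm⟩ := A.exists_integralAt x
      refine A.mem_of_word_smul_mem (LinearMap.range H) m fun w hw => ?_
      obtain ⟨v, hv⟩ := hm w hw
      have hvV : v ∈ V := by
        change A.eval ι v ∈ N
        rw [hv]
        exact N.smul_mem _ hx
      obtain ⟨c, rfl⟩ := Finsupp.mem_span_range_iff_exists_finsupp.1 (hspan hvV)
      exact ⟨A.eval P c, (hH c).trans hv⟩
  rw [← hrange]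
  exact Module.Free.of_equiv (LinearEquiv.ofInjective H hinj)

theorem free_of_projective (A : LeavittFamily K n S) [Nontrivial S] (hn : 1 < n)
    (M : Type*) [AddCommGroup M] [Module S M] [Module.Projective S M] : Module.Free S M := by
  obtain ⟨s, hs⟩ := Module.projective_def.1 ‹Module.Projective S M›
  have hinj : Function.Injective s := hs.injective
  have := A.free_submodule hn (LinearMap.range s)
  exact Module.Free.of_equiv (LinearEquiv.ofInjective s hinj).symm

theorem free_submodule_of_free (A : LeavittFamily K n S) [Nontrivial S] (hn : 1 < n)
    {M : Type*} [AddCommGroup M] [Module S M] [Module.Free S M] (N : Submodule S M) : Module.Free S N := by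
  let e := (Module.Free.chooseBasis S M).repr
  have := A.free_submodule hn (N.map e.toLinearMap)
  exact Module.Free.of_equiv (e.submoduleMap N).symm

end Free

end LeavittFamily

/-! ### Codimension count and invariance of rank modulo n - 1 -/

theorem rank_quotient_range_comp {K U : Type*} {V W : Type u} [Field K] [AddCommGroup U]
    [Module K U] [AddCommGroup V] [Module K V] [AddCommGroup W] [Module K W]
    (f : U →ₗ[K] V) (g : V →ₗ[K] W) (hg : Function.Injective g) :
    Module.rank K (W ⧸ LinearMap.range (g ∘ₗ f)) =
      Module.rank K (V ⧸ LinearMap.range f) + Module.rank K (W ⧸ LinearMap.range g) := by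
  have hle : LinearMap.range (g ∘ₗ f) ≤ LinearMap.range g := LinearMap.range_comp_le_range f g
  let N := LinearMap.range (g ∘ₗ f)
  rw [← Submodule.rank_quotient_add_rank ((LinearMap.range g).map N.mkQ), add_comm]
  congr 1
  · have hker : LinearMap.ker (N.mkQ ∘ₗ g) = LinearMap.range f := by
      rw [LinearMap.ker_comp, Submodule.ker_mkQ, show N = (LinearMap.range f).map g from
        LinearMap.range_comp f g, Submodule.comap_map_eq_of_injective hg]
    rw [← LinearMap.range_comp, ← hker]
    exact (LinearMap.quotKerEquivRange (N.mkQ ∘ₗ g)).rank_eq.symm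
  · exact (Submodule.quotientQuotientEquivQuotient N _ hle).rank_eq

theorem rank_quotient_range_compLeft {K : Type*} {V W : Type u} [Field K] [AddCommGroup V]
    [Module K V] [AddCommGroup W] [Module K W] (f : V →ₗ[K] W) (n : ℕ) :
    Module.rank K ((Fin n → W) ⧸ LinearMap.range (f.compLeft (Fin n))) =
      n * Module.rank K (W ⧸ LinearMap.range f) := by
  have h : LinearMap.range (f.compLeft (Fin n)) =
      Submodule.pi Set.univ fun _ => LinearMap.range f := by
    ext x
    simp only [LinearMap.mem_range, Submodule.mem_pi, Set.mem_univ, forall_true_left]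
    constructor
    · rintro ⟨y, rfl⟩ i
      exact ⟨y i, rfl⟩
    · intro hx
      choose y hy using hx
      exact ⟨y, funext hy⟩
  rw [h, (Submodule.quotientPi fun _ : Fin n => LinearMap.range f).rank_eq]
  simp

namespace LeavittFamily

variable {K : Type u} [Field K] {n : ℕ} {S : Type*} [Ring S] [Algebra K S]
  (A : LeavittFamily K n S)

/-- Assembling an element of the free module over the free algebra from its left cofactors. -/
noncomputable def sumShift (K : Type*) [Field K] (n : ℕ) (ι : Type*) :
    (Fin n → ι × List (Fin n) →₀ K) →ₗ[K] (ι × List (Fin n) →₀ K) :=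
  ∑ i, shift K ι [i] ∘ₗ LinearMap.proj i

theorem sumShift_apply {ι : Type*} (g : Fin n → ι × List (Fin n) →₀ K) :
    sumShift K n ι g = ∑ i, shift K ι [i] (g i) := by
  simp [sumShift]

theorem shift_cons_apply_cons {ι : Type*} (f : ι × List (Fin n) →₀ K) (i j : Fin n) (k : ι)
    (w : List (Fin n)) : shift K ι [i] f (k, j :: w) = if i = j then f (k, w) else 0 := by
  classical
  induction f using Finsupp.induction_linear with
  | zero => simp
  | add f g hf hg => rw [map_add, Finsupp.add_apply, hf, hg]; split_ifs <;> simp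
  | single x r =>
    rw [shift_single]
    simp only [Finsupp.single_apply, List.singleton_append, List.cons.injEq,
      Prod.ext_iff]
    split_ifs <;> simp_all

theorem shift_cons_apply_nil {ι : Type*} (f : ι × List (Fin n) →₀ K) (i : Fin n) (k : ι) :
    shift K ι [i] f (k, []) = 0 := by
  classical
  induction f using Finsupp.induction_linear with
  | zero => simp
  | add f g hf hg => rw [map_add, Finsupp.add_apply, hf, hg, add_zero]
  | single x r => rw [shift_single]; simp

theorem sumShift_injective (K : Type*) [Field K] (n : ℕ) (ι : Type*) :
    Function.Injective (sumShift K n ι) := by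
  intro f g h
  ext j ⟨k, w⟩
  have := DFunLike.congr_fun h (k, j :: w)
  simpa [sumShift_apply, Finsupp.finsetSum_apply, shift_cons_apply_cons] using this

/-- The coefficients of the empty words. -/
noncomputable def constCoeff (K : Type*) [Field K] (n : ℕ) (ι : Type*) :
    (ι × List (Fin n) →₀ K) →ₗ[K] (ι → K) :=
  LinearMap.pi fun k => Finsupp.lapply (k, [])

/-- A nonempty word has a unique first letter, so only the constant coefficients obstruct
divisibility; the cokernel is K^ι. -/
theorem range_sumShift (ι : Type*) :
    LinearMap.range (sumShift K n ι) = LinearMap.ker (constCoeff K n ι) := by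
  classical
  apply le_antisymm
  · rintro _ ⟨g, rfl⟩
    rw [LinearMap.mem_ker]
    ext k
    simp [constCoeff, sumShift_apply, shift_cons_apply_nil]
  · intro f hf
    have hnil : ∀ k, f (k, []) = 0 := fun k => congrFun (LinearMap.mem_ker.1 hf) k
    rw [← Finsupp.sum_single f]
    refine sum_mem fun x hx => ?_
    obtain ⟨k, w⟩ := x
    cases w with
    | nil => exact absurd (hnil k) (by simpa using hx)
    | cons i w =>
      refine ⟨Pi.single i (Finsupp.single (k, w) (f (k, i :: w))), ?_⟩
      rw [sumShift_apply, Finset.sum_eq_single i]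
      · simp
      · intro j _ hj; simp [Pi.single_eq_of_ne hj]
      · simp

theorem rank_quotient_range_sumShift (ι : Type) [Fintype ι] :
    Module.rank K ((ι × List (Fin n) →₀ K) ⧸ LinearMap.range (sumShift K n ι)) =
      Fintype.card ι := by
  classical
  have hsurj : Function.Surjective (constCoeff K n ι) := by
    intro c
    refine ⟨∑ k, Finsupp.single (k, []) (c k), ?_⟩
    ext k
    simp [constCoeff, Finsupp.single_apply]
  rw [range_sumShift, ((constCoeff K n ι).quotKerEquivOfSurjective hsurj).rank_eq]
  simp

variable {ι ι' : Type} [Fintype ι] [Fintype ι']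

/-- Let T be the F-linear restriction of φ and d the dimension of its cokernel. T commutes with left
multiplication by the `b i`, so T ∘ `sumShift` = `sumShift` ∘ T^n; the cokernels of the two sides
have dimensions |ι'| + d and n d + |ι|. -/
theorem exists_card_add_eq [Nontrivial S] (hn : 1 < n) (φ : (ι' →₀ S) ≃ₗ[S] (ι →₀ S))
    (hφ : ∀ k, φ (Finsupp.single k 1) ∈ LinearMap.range (A.eval ι)) :
    ∃ d, Fintype.card ι' + d = n * d + Fintype.card ι := by
  choose t ht using hφ
  let T : (ι' × List (Fin n) →₀ K) →ₗ[K] (ι × List (Fin n) →₀ K) :=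
    Finsupp.linearCombination K fun x => shift K ι x.2 (t x.1)
  have hT : ∀ f, A.eval ι (T f) = φ (A.eval ι' f) := by
    intro f
    induction f using Finsupp.induction_linear with
    | zero => simp
    | add f g hf hg => simp only [map_add, hf, hg]
    | single x r =>
      rw [Finsupp.linearCombination_single, map_smul, eval_shift, ht, ← map_smul, eval_single,
        Finsupp.smul_single, smul_eq_mul, mul_one, ← algebraMap_smul S r, ← algebraMap_smul S r,
        map_smul]
  have hTinj : Function.Injective T := by
    intro f g h
    apply A.eval_injective hn
    apply φ.injective
    rw [← hT, ← hT, h]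
  have hcomm : T ∘ₗ sumShift K n ι' = sumShift K n ι ∘ₗ T.compLeft (Fin n) := by
    refine LinearMap.ext fun g => A.eval_injective hn ?_
    simp only [LinearMap.comp_apply, hT, sumShift_apply, map_sum, eval_shift, map_smul,
      LinearMap.compLeft_apply, Function.comp_apply]
  -- Integrality of the preimages of the basis puts every sufficiently long word into the range of
  -- T, so finitely many short words span the cokernel.
  have hfin : Module.Finite K ((ι × List (Fin n) →₀ K) ⧸ LinearMap.range T) := by
    choose m hm using fun j : ι => A.exists_integralAt (φ.symm (Finsupp.single j 1))
    let N := Finset.univ.sup m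
    have hlong : ∀ (j : ι) (w : List (Fin n)), N ≤ w.length →
        Finsupp.single (j, w) (1 : K) ∈ LinearMap.range T := by
      intro j w hw
      have hjN : m j ≤ w.length := (Finset.le_sup (Finset.mem_univ j)).trans hw
      obtain ⟨f, hf⟩ := (hm j).mono hjN w rfl
      refine ⟨f, A.eval_injective hn ?_⟩
      rw [hT, hf, map_smul, LinearEquiv.apply_symm_apply]
      simp
    let s : Set (ι × List (Fin n)) := Set.univ ×ˢ {w | w.length < N}
    have hs : s.Finite := Set.finite_univ.prod (List.finite_length_lt _ _)
    let W := Submodule.span K ((fun x => Finsupp.single x (1 : K)) '' s)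
    have : Module.Finite K W := Module.Finite.span_of_finite K (hs.image _)
    refine Module.Finite.of_surjective ((LinearMap.range T).mkQ ∘ₗ W.subtype) ?_
    rw [← LinearMap.range_eq_top, LinearMap.range_comp, Submodule.range_subtype,
      Submodule.map_mkQ_eq_top, eq_top_iff]
    rintro f -
    rw [← Finsupp.sum_single f]
    refine sum_mem ?_
    rintro ⟨j, w⟩ -
    rw [← mul_one (f (j, w)), ← smul_eq_mul, ← Finsupp.smul_single]
    refine Submodule.smul_mem _ _ ?_
    rcases lt_or_ge w.length N with h | h
    · exact Submodule.mem_sup_right (Submodule.subset_span ⟨(j, w), ⟨trivial, h⟩, rfl⟩)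
    · exact Submodule.mem_sup_left (hlong j w h)
  refine ⟨Module.finrank K ((ι × List (Fin n) →₀ K) ⧸ LinearMap.range T), ?_⟩
  have h := rank_quotient_range_comp (sumShift K n ι') T hTinj
  rw [hcomm, rank_quotient_range_comp _ _ (sumShift_injective K n ι),
    rank_quotient_range_compLeft, rank_quotient_range_sumShift, rank_quotient_range_sumShift,
    ← Module.finrank_eq_rank] at h
  exact_mod_cast h.symm

/-- The free `S`-modules on `κ × Fin n` and on `κ` are isomorphic. -/
noncomputable def finsuppProdEquiv (κ : Type*) : (κ × Fin n →₀ S) ≃ₗ[S] (κ →₀ S) :=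
  LinearEquiv.ofLinearMap
    (Finsupp.linearCombination S fun x => A.b x.2 • Finsupp.single x.1 1)
    (Finsupp.linearCombination S fun k => ∑ i, A.a i • Finsupp.single (k, i) 1)
    (by
      refine Finsupp.lhom_ext' fun k => LinearMap.ext_ring ?_
      simp only [LinearMap.comp_apply, Finsupp.lsingle_apply, Finsupp.linearCombination_single,
        one_smul, map_sum, map_smul, LinearMap.id_apply]
      exact A.sum_a_smul_b_smul _)
    (by
      refine Finsupp.lhom_ext' fun x => LinearMap.ext_ring ?_
      simp only [LinearMap.comp_apply, Finsupp.lsingle_apply, Finsupp.linearCombination_single,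
        one_smul, map_smul, LinearMap.id_apply, Finset.smul_sum, smul_smul, one_mul, A.b_mul_a,
        ite_smul, zero_smul, Finset.sum_ite_eq, Finset.mem_univ, if_true])

theorem finsuppProdEquiv_single (κ : Type*) (x : κ × Fin n) :
    A.finsuppProdEquiv κ (Finsupp.single x 1) = A.b x.2 • Finsupp.single x.1 1 := by
  simp only [finsuppProdEquiv, LinearEquiv.coe_ofLinearMap, Finsupp.linearCombination_single,
    one_smul]

/-- Induction on `m`: replacing each basis vector e_k by the n vectors b_i e_k lowers the required
length by one and multiplies the rank by n, which is 1 modulo n - 1. -/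
theorem card_modEq_of_integralAt [Nontrivial S] (hn : 1 < n) (m : ℕ) {ι' : Type} [Fintype ι']
    (φ : (ι' →₀ S) ≃ₗ[S] (ι →₀ S)) (hφ : ∀ k, A.IntegralAt m (φ (Finsupp.single k 1))) :
    Fintype.card ι' ≡ Fintype.card ι [MOD n - 1] := by
  have hn1 : n ≡ 1 [MOD n - 1] := ((Nat.modEq_iff_dvd' hn.le).2 dvd_rfl).symm
  induction m generalizing ι' with
  | zero =>
    obtain ⟨d, hd⟩ := A.exists_card_add_eq hn φ fun k => by simpa using hφ k [] rfl
    refine Nat.ModEq.add_right_cancel' d ?_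
    rw [hd, add_comm]
    simpa using (hn1.mul_right d).add_left (Fintype.card ι)
  | succ m ih =>
    have := ih ((A.finsuppProdEquiv ι').trans φ) fun x => by
      rw [LinearEquiv.trans_apply, finsuppProdEquiv_single, map_smul]
      exact (hφ x.1).b_smul x.2
    rw [Fintype.card_prod, Fintype.card_fin] at this
    exact (by simpa using (hn1.mul_left (Fintype.card ι')).symm : _ ≡ _ [MOD n - 1]).trans this

theorem modEq_of_linearEquiv (A : LeavittFamily K n S) [Nontrivial S] (hn : 1 < n) {m m' : ℕ}
    (φ : (Fin m → S) ≃ₗ[S] (Fin m' → S)) : m ≡ m' [MOD n - 1] := by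
  let ψ : (Fin m →₀ S) ≃ₗ[S] (Fin m' →₀ S) :=
    (Finsupp.linearEquivFunOnFinite S S (Fin m)).trans
      (φ.trans (Finsupp.linearEquivFunOnFinite S S (Fin m')).symm)
  choose N hN using fun k : Fin m => A.exists_integralAt (ψ (Finsupp.single k 1))
  simpa using A.card_modEq_of_integralAt hn (Finset.univ.sup N) ψ fun k =>
    (hN k).mono (Finset.le_sup (Finset.mem_univ k))

theorem nonempty_linearEquiv (A : LeavittFamily K n S) :
    Nonempty ((Fin 1 → S) ≃ₗ[S] (Fin n → S)) :=
  ⟨((Finsupp.linearEquivFunOnFinite S S (Fin 1)).symm.trans (A.finsuppProdEquiv (Fin 1)).symm).trans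
    ((Finsupp.domLCongr (Equiv.uniqueProd (Fin n) (Fin 1))).trans
      (Finsupp.linearEquivFunOnFinite S S (Fin n)))⟩

end LeavittFamily

/-! ### The Leavitt algebra, its opposite, and its nontriviality -/

namespace LeavittAlgebra

variable (K : Type u) [Field K] (n : ℕ)

/-- The image of a generator of the free algebra. -/
noncomputable def gen (x : Fin n ⊕ Fin n) : LeavittAlgebra K n :=
  RingQuot.mkAlgHom K (LeavittRel K n) (FreeAlgebra.ι K x)

theorem adjoin_gen : Algebra.adjoin K (Set.range (gen K n)) = ⊤ := by
  have h := FreeAlgebra.adjoin_range_ι K (Fin n ⊕ Fin n)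
  have h2 := congrArg (Subalgebra.map (RingQuot.mkAlgHom K (LeavittRel K n))) h
  rw [AlgHom.map_adjoin, Algebra.map_top,
    (AlgHom.range_eq_top _).2 (RingQuot.mkAlgHom_surjective K _), ← Set.range_comp] at h2
  exact h2

/-- The generators of the Leavitt algebra. -/
noncomputable def family : LeavittFamily K n (LeavittAlgebra K n) where
  a i := gen K n (Sum.inl i)
  b i := gen K n (Sum.inr i)
  b_mul_a j i := by
    change RingQuot.mkAlgHom K (LeavittRel K n) _ * RingQuot.mkAlgHom K (LeavittRel K n) _ = _
    rw [← map_mul]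
    split_ifs with h
    · subst h
      exact (RingQuot.mkAlgHom_rel K (LeavittRel.star_mul_self j)).trans (map_one _)
    · exact (RingQuot.mkAlgHom_rel K (LeavittRel.star_mul_of_ne j i h)).trans (map_zero _)
  sum_a_mul_b := by
    have := RingQuot.mkAlgHom_rel K (LeavittRel.sum_mul_star (K := K) (n := n))
    rw [map_sum, map_one] at this
    simp only [map_mul] at this
    exact this
  adjoin_eq_top := by
    rw [← adjoin_gen, ← Set.Sum.elim_range]
    exact congrArg (fun f => Algebra.adjoin K (Set.range f)) (Sum.elim_comp_inl_inr (gen K n))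

/-- The generators of the opposite of the Leavitt algebra. -/
noncomputable def opFamily : LeavittFamily K n (LeavittAlgebra K n)ᵐᵒᵖ where
  a i := MulOpposite.op ((family K n).b i)
  b i := MulOpposite.op ((family K n).a i)
  b_mul_a j i := by
    rw [← MulOpposite.op_mul, (family K n).b_mul_a]
    by_cases h : j = i
    · simp [h]
    · simp [h, Ne.symm h]
  sum_a_mul_b := by
    simp_rw [← MulOpposite.op_mul]
    rw [← Finset.op_sum, (family K n).sum_a_mul_b, MulOpposite.op_one]
  adjoin_eq_top := by
    have h := congrArg Subalgebra.op (family K n).adjoin_eq_top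
    rw [Subalgebra.op_adjoin, Subalgebra.op_top] at h
    rw [← h]
    congr 1
    ext x
    simp only [Set.mem_union, Set.mem_range, Set.mem_preimage, ← MulOpposite.unop_inj,
      MulOpposite.unop_op]
    tauto

variable {n}

/-- The operators on sequences which spread a sequence over a residue class, and which restrict
a sequence to a residue class. -/
noncomputable def seqGen : Fin n ⊕ Fin n → Module.End K (ℕ → K)
  | Sum.inl i => LinearMap.pi fun k => if k % n = i then LinearMap.proj (k / n) else 0
  | Sum.inr i => LinearMap.pi fun k => LinearMap.proj (n * k + i)

/-- Division with remainder by n identifies ℕ with n copies of itself, which makes L act on the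
nonzero space of sequences. -/
theorem nontrivial (hn : 1 < n) : Nontrivial (LeavittAlgebra K n) := by
  have hrel : ∀ ⦃x y⦄, LeavittRel K n x y →
      FreeAlgebra.lift K (seqGen K (n := n)) x = FreeAlgebra.lift K (seqGen K (n := n)) y := by
    have hmod : ∀ (k : ℕ) (j : Fin n), (n * k + j) % n = j := fun k j => by
      rw [Nat.mul_add_mod, Nat.mod_eq_of_lt j.2]
    have hdiv : ∀ (k : ℕ) (j : Fin n), (n * k + j) / n = k := fun k j => by
      rw [Nat.mul_add_div (by omega), Nat.div_eq_of_lt j.2, add_zero]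
    intro x y h
    cases h with
    | star_mul_self i =>
      rw [map_mul, FreeAlgebra.lift_ι_apply, FreeAlgebra.lift_ι_apply, map_one]
      refine LinearMap.ext fun f => funext fun k => ?_
      simp [seqGen, hmod, hdiv]
    | star_mul_of_ne j i h =>
      rw [map_mul, FreeAlgebra.lift_ι_apply, FreeAlgebra.lift_ι_apply, map_zero]
      refine LinearMap.ext fun f => funext fun k => ?_
      simp [seqGen, hmod, Fin.val_inj, h]
    | sum_mul_star =>
      rw [map_sum, map_one]
      simp only [map_mul, FreeAlgebra.lift_ι_apply]
      refine LinearMap.ext fun f => funext fun k => ?_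
      rw [LinearMap.sum_apply, Finset.sum_apply, Finset.sum_eq_single
        (⟨k % n, Nat.mod_lt _ (by omega)⟩ : Fin n)]
      · simp [seqGen, Nat.div_add_mod]
      · intro i _ hi
        have : k % n ≠ i := fun h => hi (Fin.ext h.symm)
        simp [seqGen, this]
      · simp
  exact (RingQuot.liftAlgHom K ⟨FreeAlgebra.lift K (seqGen K), hrel⟩ :
    RingQuot (LeavittRel K n) →ₐ[K] Module.End K (ℕ → K)).toRingHom.domain_nontrivial

end LeavittAlgebra

/-! ### Right modules as modules over the opposite ring -/

section Opposite

variable (R : Type*) [Ring R]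

/-- A ring as a right module over itself. -/
def opSelfEquiv : Rᵐᵒᵖ ≃ₗ[Rᵐᵒᵖ] R where
  toFun := MulOpposite.unop
  invFun := MulOpposite.op
  map_add' _ _ := rfl
  map_smul' _ _ := rfl
  left_inv _ := rfl
  right_inv _ := rfl

/-- Free right modules of finite rank as left modules over the opposite ring. -/
def opPiEquiv (m : ℕ) : (Fin m → Rᵐᵒᵖ) ≃ₗ[Rᵐᵒᵖ] (Fin m → R) :=
  LinearEquiv.piCongrRight fun _ => opSelfEquiv R

theorem freeRanksIso_iff (m m' : ℕ) :
    FreeRanksIso R m m' ↔ Nonempty ((Fin m → Rᵐᵒᵖ) ≃ₗ[Rᵐᵒᵖ] (Fin m' → Rᵐᵒᵖ)) :=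
  ⟨fun ⟨e⟩ => ⟨(opPiEquiv R m).trans (e.trans (opPiEquiv R m').symm)⟩,
    fun ⟨e⟩ => ⟨(opPiEquiv R m).symm.trans (e.trans (opPiEquiv R m'))⟩⟩

end Opposite

/-! ### The Grothendieck group -/

section KZero

open Algebra

variable {R : Type u} [Ring R]

/-- The class of the free right module of rank `k`. -/
def freeClass (R : Type u) [Ring R] (k : ℕ) : FGProjRight.Classes R :=
  haveI : Module.Free Rᵐᵒᵖ R := Module.Free.of_equiv (opSelfEquiv R)
  haveI : Module.Finite Rᵐᵒᵖ R := Module.Finite.equiv (opSelfEquiv R)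
  Quotient.mk _ ⟨Fin k → R⟩

theorem freeClass_eq_iff (k l : ℕ) : freeClass R k = freeClass R l ↔ FreeRanksIso R k l :=
  Quotient.eq

theorem freeClass_add (k l : ℕ) : freeClass R (k + l) = freeClass R k + freeClass R l :=
  Quotient.sound ⟨(LinearEquiv.sumArrowLequivProdArrow (Fin k) (Fin l) Rᵐᵒᵖ R).symm.trans
    (LinearEquiv.funCongrLeft Rᵐᵒᵖ R finSumFinEquiv.symm) |>.symm⟩

theorem freeClass_zero : freeClass R 0 = 0 :=
  Quotient.sound ⟨LinearEquiv.ofSubsingleton _ _⟩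

theorem exists_freeClass_eq [Nontrivial R]
    (hfree : ∀ (P : Type u) [AddCommGroup P] [Module Rᵐᵒᵖ P],
      Module.Projective Rᵐᵒᵖ P → Module.Free Rᵐᵒᵖ P) (c : FGProjRight.Classes R) :
    ∃ k, freeClass R k = c := by
  induction c using Quotient.inductionOn with
  | h P =>
    have := hfree P.carrier P.projective
    let e := (Module.Free.chooseBasis Rᵐᵒᵖ P.carrier).reindex (Fintype.equivFin _)
    exact ⟨_, Quotient.sound ⟨(opPiEquiv R _).symm.trans e.equivFun.symm⟩⟩

theorem nonempty_kZero_equiv_zmod {n : ℕ} (hn : 1 < n)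
    (hsurj : ∀ c : FGProjRight.Classes R, ∃ k, freeClass R k = c)
    (hiso : FreeRanksIso R 1 n)
    (hmod : ∀ k l, FreeRanksIso R k l → k ≡ l [MOD n - 1]) :
    Nonempty (KZero R ≃+ ZMod (n - 1)) := by
  -- The rank is an arbitrary choice, well defined and additive only modulo n - 1.
  choose rk hrk using hsurj
  have hrk_free : ∀ k, (rk (freeClass R k) : ZMod (n - 1)) = k := fun k =>
    (ZMod.natCast_eq_natCast_iff _ _ _).2 (hmod _ _ ((freeClass_eq_iff _ _).1 (hrk _)))
  let r : FGProjRight.Classes R →+ ZMod (n - 1) :=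
    { toFun := fun c => rk c
      map_zero' := by rw [← freeClass_zero, hrk_free, Nat.cast_zero]
      map_add' := fun c d => by
        conv_lhs => rw [← hrk c, ← hrk d]
        rw [← freeClass_add, hrk_free, Nat.cast_add] }
  have hr : ∀ k, r (freeClass R k) = k := hrk_free
  let of : FGProjRight.Classes R →+ KZero R := GrothendieckAddGroup.of
  let f : KZero R →+ ZMod (n - 1) := GrothendieckAddGroup.lift r
  have hf : ∀ c, f (of c) = r c := fun c =>
    DFunLike.congr_fun (GrothendieckAddGroup.lift.symm_apply_apply r) c
  have hnsmul : ∀ k : ℕ, of (freeClass R k) = k • of (freeClass R 1) := by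
    intro k
    induction k with
    | zero => rw [freeClass_zero, map_zero, zero_smul]
    | succ k ih => rw [freeClass_add, map_add, ih, succ_nsmul]
  -- Cancel one copy of [R] in n[R] = [R].
  have hzero : (n - 1) • of (freeClass R 1) = 0 := by
    have h := hnsmul n
    rw [← (freeClass_eq_iff 1 n).2 hiso] at h
    rw [← add_left_inj (of (freeClass R 1)), ← succ_nsmul, Nat.sub_add_cancel hn.le, ← h, zero_add]
  have hgen : ∀ x : KZero R, ∃ z : ℤ, x = z • of (freeClass R 1) := by
    intro x
    induction x using AddLocalization.ind with
    | H y =>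
      obtain ⟨c, d, -⟩ := y
      refine ⟨(rk c : ℤ) - rk d, ?_⟩
      rw [sub_smul, natCast_zsmul, natCast_zsmul, ← hnsmul, ← hnsmul, hrk, hrk]
      change _ = AddLocalization.mk c 0 - AddLocalization.mk d 0
      rw [GrothendieckAddGroup.mk_sub_mk]
      simp
  refine ⟨AddEquiv.ofBijective f ⟨?_, ?_⟩⟩
  · refine (injective_iff_map_eq_zero f).2 fun x hx => ?_
    obtain ⟨z, rfl⟩ := hgen x
    rw [map_zsmul, hf, hr, Nat.cast_one, zsmul_one, ZMod.intCast_zmod_eq_zero_iff_dvd] at hx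
    obtain ⟨w, rfl⟩ := hx
    rw [mul_comm, mul_smul, natCast_zsmul, hzero, smul_zero]
  · intro z
    obtain ⟨k, rfl⟩ := ZMod.intCast_surjective z
    exact ⟨k • of (freeClass R 1), by rw [map_zsmul, hf, hr, Nat.cast_one, zsmul_one]⟩

end KZero

theorem theorem3p4 (K : Type u) [Field K] (n : ℕ) (hn : 1 < n) :
    IsSimpleRing (LeavittAlgebra K n) ∧
    AllRightIdealsFree (LeavittAlgebra K n) ∧
    IsHereditaryRing (LeavittAlgebra K n) ∧
    IsProjectiveFree.{u, w} (LeavittAlgebra K n) ∧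
    HasModuleType (LeavittAlgebra K n) 1 n ∧
    Nonempty (KZero (LeavittAlgebra K n) ≃+ ZMod (n - 1)) := by
  have := LeavittAlgebra.nontrivial K hn
  let A := LeavittAlgebra.family K n
  let B := LeavittAlgebra.opFamily K n
  have hR : Module.Free (LeavittAlgebra K n)ᵐᵒᵖ (LeavittAlgebra K n) :=
    Module.Free.of_equiv (opSelfEquiv _)
  have hright : AllRightIdealsFree (LeavittAlgebra K n) := fun J => B.free_submodule_of_free hn J
  have hmod : ∀ k l, FreeRanksIso (LeavittAlgebra K n) k l → k ≡ l [MOD n - 1] := fun k l h => by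
    obtain ⟨φ⟩ := (freeRanksIso_iff _ _ _).1 h
    exact B.modEq_of_linearEquiv hn φ
  have hiso : FreeRanksIso (LeavittAlgebra K n) 1 n :=
    (freeRanksIso_iff _ _ _).2 B.nonempty_linearEquiv
  refine ⟨A.isSimpleRing hn, hright, ⟨fun J => ?_, fun J => ?_⟩,
    ⟨fun P _ _ _ => B.free_of_projective hn P, fun P _ _ _ => A.free_of_projective hn P⟩,
    ⟨le_rfl, hn, hiso, fun m' n' hm' hlt h => ⟨hm', ?_⟩⟩,
    nonempty_kZero_equiv_zmod hn
      (exists_freeClass_eq fun P _ _ _ => B.free_of_projective hn P) hiso hmod⟩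
  · have := hright J
    infer_instance
  · have := A.free_submodule_of_free hn J
    infer_instance
  -- n - 1 divides n' - m' > 0, and m' ≥ 1 supplies the missing unit in n ≤ n'.
  · have := Nat.le_of_dvd (by omega) ((Nat.modEq_iff_dvd' hlt.le).1 (hmod _ _ h))
    omega
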